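/- Let $n\ge 1$, $A\in\mathbb R^{n\times n}$ and $b\in\mathbb R^n$. Suppose that the single-input continuous-time system $\dot x=Ax+bu$ is state controllable (every state can be steered to every other state in some finite time by some input $u$) and that all eigenvalues of $A$ are negative real numbers. Let $$R_b(\infty)=\Big\{\int_0^\infty e^{At}b\,z(t)\,dt \;:\; z\in L^2(0,\infty),\ \|z\|_{2}\le 1\Big\}$$ be the infinite-time controllability ellipsoid, let $\det(sI-A)=s^n+a_1s^{n-1}+\dots+a_n$, put $a_0=1$ and $a_k=0$ for $k<0$ or $k>n$, and let $H^{(n)}=(a_{2j-i})_{1\le i,j\le n}$ be the Hurwitz matrix of this polynomial. Let $W_c$ be the inverse of the matrix with rows $w_1,w_1A,\dots,w_1A^{n-1}$, where $w_1=[0,\dots,0,1]\,[b,Ab,\dots,A^{n-1}b]^{-1}$; that is, $x=W_cx_c$ is the state transformation to the controllable canonical form. Then all the inverses above exist, $\det H^{(n)}\ne 0$, and $$\operatorname{vol}\big(R_b(\infty)\big)=\Pi_n\Big(\frac{a_n}{2^n}\Big)^{1/2}\left|\frac{\det W_c}{\det H^{(n)}}\right|,\qquad \Pi_n=\frac{\pi^{n/2}}{\Gamma(n/2+1)}.$$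 -/

import Mathlib

open MeasureTheory Set

noncomputable section

/-- The system `x' = A x + b u` with one input is state controllable: every state `x₀` can be
steered to every state `x₁` in some finite time `T` by a (continuous) input `u`. -/
def StateControllable {n : ℕ} (A : Matrix (Fin n) (Fin n) ℝ) (b : Fin n → ℝ) : Prop :=
  ∀ x₀ x₁ : Fin n → ℝ, ∃ T : ℝ, 0 < T ∧ ∃ (u : ℝ → ℝ) (x : ℝ → Fin n → ℝ),
    ContinuousOn u (Icc 0 T) ∧
    (∀ t ∈ Icc 0 T, HasDerivWithinAt x (A.mulVec (x t) + u t • b) (Icc 0 T) t) ∧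
    x 0 = x₀ ∧ x T = x₁

/-- All eigenvalues, a priori complex, of the real matrix `A` are negative real numbers. -/
def HasNegativeRealEigenvalues {n : ℕ} (A : Matrix (Fin n) (Fin n) ℝ) : Prop :=
  ∀ μ : ℂ, Module.End.HasEigenvalue (Matrix.toLin' (A.map (algebraMap ℝ ℂ))) μ →
    ∃ r : ℝ, r < 0 ∧ μ = (r : ℂ)

/-- The infinite-time controllability ellipsoid: the set of all `∫₀^∞ e^{At} b z(t) dt` with
`z ∈ L²(0, ∞)` of norm at most one. -/
def controllabilityEllipsoid {n : ℕ} (A : Matrix (Fin n) (Fin n) ℝ) (b : Fin n → ℝ) :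
    Set (Fin n → ℝ) :=
  {x | ∃ z : ℝ → ℝ, MemLp z 2 (volume.restrict (Ioi (0 : ℝ))) ∧
    eLpNorm z 2 (volume.restrict (Ioi (0 : ℝ))) ≤ 1 ∧
    IntegrableOn (fun t : ℝ => z t • (NormedSpace.exp (t • A)).mulVec b) (Ioi (0 : ℝ)) ∧
    x = ∫ t in Ioi (0 : ℝ), z t • (NormedSpace.exp (t • A)).mulVec b}

/-- The controllability matrix `[b, A b, …, A^{n-1} b]`. -/
def controllabilityMatrix {n : ℕ} (A : Matrix (Fin n) (Fin n) ℝ) (b : Fin n → ℝ) :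
    Matrix (Fin n) (Fin n) ℝ :=
  Matrix.of fun i j => ((A ^ (j : ℕ)).mulVec b) i

/-- The row `w₁ = [0, …, 0, 1] [b, A b, …, A^{n-1} b]⁻¹`. -/
def ccfRow {n : ℕ} (A : Matrix (Fin n) (Fin n) ℝ) (b : Fin n → ℝ) : Fin n → ℝ :=
  Matrix.vecMul (fun i : Fin n => if (i : ℕ) + 1 = n then (1 : ℝ) else 0)
    (controllabilityMatrix A b)⁻¹

/-- The matrix with rows `w₁, w₁ A, …, w₁ A^{n-1}`. -/
def ccfInverseTransformation {n : ℕ} (A : Matrix (Fin n) (Fin n) ℝ) (b : Fin n → ℝ) :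
    Matrix (Fin n) (Fin n) ℝ :=
  Matrix.of fun i => Matrix.vecMul (ccfRow A b) (A ^ (i : ℕ))

/-- The matrix `W_c` of the state transformation `x = W_c x_c` to the controllable
canonical form. -/
def ccfTransformation {n : ℕ} (A : Matrix (Fin n) (Fin n) ℝ) (b : Fin n → ℝ) :
    Matrix (Fin n) (Fin n) ℝ :=
  (ccfInverseTransformation A b)⁻¹

/-- The coefficient `a_k` of the characteristic polynomial
`det (s I - A) = s^n + a₁ s^{n-1} + ⋯ + a_n`, with `a₀ = 1`, and `a_k = 0` for `k < 0`
and for `k > n`. -/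
def charCoeff {n : ℕ} (A : Matrix (Fin n) (Fin n) ℝ) (k : ℤ) : ℝ :=
  if 0 ≤ k ∧ k ≤ (n : ℤ) then A.charpoly.coeff (n - k.toNat) else 0

/-- The Hurwitz matrix of the characteristic polynomial of `A`. With indices from `1` to `n`
the entry in row `i` and column `j` is `a_{2j-i}`; here the indices start at `0`. -/
def hurwitzMatrix {n : ℕ} (A : Matrix (Fin n) (Fin n) ℝ) : Matrix (Fin n) (Fin n) ℝ :=
  Matrix.of fun i j => charCoeff A (2 * ((j : ℕ) : ℤ) + 1 - ((i : ℕ) : ℤ))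

/-- The hypersphere volume coefficient `Π_n = π^{n/2} / Γ(n/2 + 1)`. -/
def ballCoeff (n : ℕ) : ℝ :=
  Real.pi ^ ((n : ℝ) / 2) / Real.Gamma ((n : ℝ) / 2 + 1)

end

/-!
The ellipsoid is the image of the unit ball of `L²(0, ∞)` under `z ↦ ∫ z φ`, with
`φ t = e^{tA} b`. If `G = ∫ φ φᵀ` is the Gramian and `G = S Sᵀ`, then the components of `S⁻¹ φ` are
orthonormal, so that by Bessel's inequality the ellipsoid is `S` applied to the Euclidean unit ball
and has volume `Π_n √(det G)` (`volume_image_unitBall`). It remains to compute `det G`. Write `p` for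
the characteristic polynomial of `A` and `C` for the controllability matrix.

* Since `φ' = A φ` and `φ` decays exponentially, `A G + G Aᵀ = -b bᵀ` (`lyapunov_gramian`).
  Hence `A ^ k G - G (-Aᵀ) ^ k` is a sum of the matrices `A ^ i b (A ^ j b)ᵀ`, up to sign. Weighting
  with the coefficients of `p` and using `p(A) = 0` gives `G p(-Aᵀ) = C T D Cᵀ` with `T` a
  Hankel matrix of coefficients and `D` a diagonal sign matrix, both of determinant `±1`. So
  `|det G| |det p(-A)| = (det C)²` (`abs_det_mul_abs_det_of_lyapunov`).
* Reversing both index ranges turns the Hurwitz matrix into the matrix `E` of coefficients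
  at even powers in `p, x p, …, x^{n-1} p`. Let `C₂ = [b, A² b, A⁴ b, …]`. As `p(A) = 0`, twice
  the even part of `x ^ k p`, evaluated at `A`, is `(-A) ^ k p(-A)`; this says
  `2 C₂ Eᵀ = p(-A) C D` (`two_smul_evenControllabilityMatrix_mul`).
  The `n × 2n` matrix `[b, A b, …, A^{2n-1} b]` and the coefficient matrix of the `x ^ k p` have
  orthogonal rows, so their complementary minors are proportional. Its odd columns are `A C₂`,
  whence `|det A| |det C₂| = |det C| |det E|` (`abs_det_mul_evenControllabilityMatrix`).
  Eliminating `det C₂` gives `2 ^ n (det H)² = a_n |det p(-A)|`.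
* The rows `w₁ A ^ i` times `C` form a matrix that is `0` above its antidiagonal and `1` on it, so
  `|det W_c| = |det C|`.

Altogether `det G = (det W_c)² a_n / (2 ^ n (det H)²)`. Controllability gives `det C ≠ 0`, and with it
the first identity makes `p(-A)` and `G` invertible, the second one `H`.
-/

/-! ### Antitriangular matrices -/

/-- A matrix that vanishes above its antidiagonal and is `1` on it has determinant `±1`. -/
lemma abs_det_eq_one_of_antitriangular {n : ℕ} (M : Matrix (Fin n) (Fin n) ℝ)
    (h0 : ∀ i j : Fin n, (i : ℕ) + j + 1 < n → M i j = 0)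
    (h1 : ∀ i j : Fin n, (i : ℕ) + j + 1 = n → M i j = 1) : |M.det| = 1 := by
  have key : (M.submatrix (Equiv.refl (Fin n)) Fin.revPerm).det = 1 := by
    rw [Matrix.det_of_isLowerTriangular]
    · refine Finset.prod_eq_one fun i _ => h1 _ _ ?_
      simp only [Equiv.refl_apply, Fin.revPerm_apply, Fin.val_rev]
      omega
    · intro i j hij
      have hij' : (i : ℕ) < j := hij
      refine h0 _ _ ?_
      simp only [Equiv.refl_apply, Fin.revPerm_apply, Fin.val_rev]
      omega
  rw [← Matrix.abs_det_submatrix_equiv_equiv (Equiv.refl (Fin n)) Fin.revPerm M, key, abs_one]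

/-! ### The determinant of a solution of the Lyapunov equation -/

section Lyapunov

open Matrix Polynomial

lemma natDegree_charpoly_fin {n : ℕ} (A : Matrix (Fin n) (Fin n) ℝ) :
    A.charpoly.natDegree = n := by
  simp

variable {n : ℕ} (A G N M : Matrix (Fin n) (Fin n) ℝ) (b : Fin n → ℝ)

/-- The difference `A ^ k G - G N ^ k` telescopes into copies of `A G - G N`. -/
lemma pow_mul_sub_mul_pow (h : A * G - G * N = -M) (k : ℕ) :
    A ^ k * G - G * N ^ k = -∑ i ∈ Finset.range k, A ^ i * M * N ^ (k - 1 - i) := by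
  induction k with
  | zero => simp
  | succ k ih =>
    have e : A ^ (k + 1) * G - G * N ^ (k + 1)
        = A * (A ^ k * G - G * N ^ k) + (A * G - G * N) * N ^ k := by
      rw [pow_succ', pow_succ']; noncomm_ring
    rw [e, ih, h, Finset.sum_range_succ', mul_neg, Finset.mul_sum, neg_add]
    congr 1
    · congr 1
      refine Finset.sum_congr rfl fun i _ => ?_
      rw [pow_succ', show k + 1 - 1 - (i + 1) = k - 1 - i by omega]
      simp only [mul_assoc]
    · simp

/-- Both sides sum `p.coeff (i + j + 1) • F i j` over `i + j < n`. -/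
lemma sum_coeff_smul_sum_range {V : Type*} [AddCommGroup V] [Module ℝ V] (p : ℝ[X])
    (hp : p.natDegree ≤ n) (F : ℕ → ℕ → V) :
    ∑ k ∈ Finset.range (n + 1), p.coeff k • ∑ i ∈ Finset.range k, F i (k - 1 - i)
      = ∑ i ∈ Finset.range n, ∑ j ∈ Finset.range n, p.coeff (i + j + 1) • F i j := by
  simp_rw [Finset.smul_sum]
  rw [← Finset.sum_product', Finset.sum_sigma']
  rw [← Finset.sum_filter_of_ne (s := Finset.range n ×ˢ Finset.range n)
    (p := fun x => x.1 + x.2 < n)]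
  · refine Finset.sum_nbij' (fun x => (x.2, x.1 - 1 - x.2)) (fun x => ⟨x.1 + x.2 + 1, x.1⟩)
      ?_ ?_ ?_ ?_ ?_
    · rintro ⟨k, i⟩ h
      simp only [Finset.mem_sigma, Finset.mem_range, Finset.mem_filter, Finset.mem_product] at h ⊢
      omega
    · rintro ⟨i, j⟩ h
      simp only [Finset.mem_sigma, Finset.mem_range, Finset.mem_filter, Finset.mem_product] at h ⊢
      omega
    · rintro ⟨k, i⟩ h
      simp only [Finset.mem_sigma, Finset.mem_range] at h
      simp only [Sigma.mk.injEq, heq_eq_eq, and_true]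
      omega
    · rintro ⟨i, j⟩ h
      simp only [Prod.mk.injEq, true_and]
      omega
    · rintro ⟨k, i⟩ h
      simp only [Finset.mem_sigma, Finset.mem_range] at h
      simp only
      congr 2
      omega
  · rintro ⟨i, j⟩ - h
    by_contra hij
    exact h (by rw [coeff_eq_zero_of_natDegree_lt (by simp only at hij; omega), zero_smul])

/-- The Hankel matrix of the coefficients `c₁, …, cₙ` of a polynomial. -/
noncomputable def coeffHankel (n : ℕ) (p : ℝ[X]) : Matrix (Fin n) (Fin n) ℝ :=
  Matrix.of fun i j => p.coeff (i + j + 1)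

lemma abs_det_coeffHankel (p : ℝ[X]) (hp : p.Monic) (hn : p.natDegree = n) :
    |(coeffHankel n p).det| = 1 := by
  rw [← Matrix.abs_det_submatrix_equiv_equiv Fin.revPerm Fin.revPerm]
  apply abs_det_eq_one_of_antitriangular
  · intro i j h
    apply coeff_eq_zero_of_natDegree_lt
    simp only [Fin.revPerm_apply, Fin.val_rev]
    omega
  · intro i j h
    have : ((Fin.revPerm i : Fin n) : ℕ) + (Fin.revPerm j : Fin n) + 1 = n := by
      simp only [Fin.revPerm_apply, Fin.val_rev]
      omega
    simp only [Matrix.submatrix_apply, coeffHankel, Matrix.of_apply, this]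
    rw [← hn]
    exact hp

lemma abs_det_diagonal_neg_one_pow (n : ℕ) :
    |(Matrix.diagonal fun j : Fin n => (-1 : ℝ) ^ (j : ℕ)).det| = 1 := by
  simp [Matrix.det_diagonal, Finset.abs_prod]

/-- The Lyapunov equation, summed against the coefficients of the characteristic polynomial; the
term `p(A) G` vanishes by Cayley–Hamilton. -/
lemma mul_aeval_neg_transpose_of_lyapunov
    (hG : A * G + G * Aᵀ = -Matrix.vecMulVec b b) :
    G * aeval (-Aᵀ) A.charpoly
      = controllabilityMatrix A b * coeffHankel n A.charpoly *
        (Matrix.diagonal fun j : Fin n => (-1 : ℝ) ^ (j : ℕ)) * (controllabilityMatrix A b)ᵀ := by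
  have hdeg := natDegree_charpoly_fin A
  have h : A * G - G * (-Aᵀ) = -Matrix.vecMulVec b b := by rw [← hG]; noncomm_ring
  have h1 : aeval A A.charpoly * G - G * aeval (-Aᵀ) A.charpoly
      = -∑ i ∈ Finset.range n, ∑ j ∈ Finset.range n,
          A.charpoly.coeff (i + j + 1) • (A ^ i * Matrix.vecMulVec b b * (-Aᵀ) ^ j) := by
    rw [← sum_coeff_smul_sum_range A.charpoly hdeg.le, aeval_eq_sum_range' (n := n + 1) (by omega),
      aeval_eq_sum_range' (n := n + 1) (by omega), Finset.sum_mul, Finset.mul_sum,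
      ← Finset.sum_sub_distrib, ← Finset.sum_neg_distrib]
    refine Finset.sum_congr rfl fun k _ => ?_
    rw [smul_mul_assoc, mul_smul_comm, ← smul_sub, pow_mul_sub_mul_pow A G _ _ h, smul_neg]
  rw [Matrix.aeval_self_charpoly, zero_mul, zero_sub, neg_inj] at h1
  rw [h1]
  ext r s
  simp only [Finset.sum_range, Matrix.sum_apply, Matrix.smul_apply, smul_eq_mul]
  have e : ∀ i j : ℕ, (A ^ i * Matrix.vecMulVec b b * (-Aᵀ) ^ j) r s
      = ((A ^ i) *ᵥ b) r * ((-1) ^ j * ((A ^ j) *ᵥ b) s) := by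
    intro i j
    rw [Matrix.mul_vecMulVec, Matrix.vecMulVec_mul, Matrix.vecMulVec_apply, neg_pow,
      ← Matrix.transpose_pow, ← Matrix.vecMul_vecMul]
    congr 1
    rw [Matrix.vecMul_transpose]
    rcases neg_one_pow_eq_or (Matrix (Fin n) (Fin n) ℝ) j with h | h <;>
      rcases Nat.even_or_odd j with h' | h' <;> 
      simp [h'.neg_one_pow, Matrix.vecMul_neg, Matrix.mulVec_neg]
  simp only [e]
  rw [Matrix.mul_apply]
  simp only [Matrix.mul_diagonal]
  simp only [Matrix.mul_apply, controllabilityMatrix, coeffHankel,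
    Matrix.of_apply, Matrix.transpose_apply, Finset.sum_mul]
  rw [Finset.sum_comm]
  refine Finset.sum_congr rfl fun j _ => Finset.sum_congr rfl fun i _ => ?_
  ring

lemma abs_det_mul_abs_det_of_lyapunov (hG : A * G + G * Aᵀ = -Matrix.vecMulVec b b) :
    |G.det| * |(aeval (-A) A.charpoly).det| = |(controllabilityMatrix A b).det| ^ 2 := by
  have hdeg := natDegree_charpoly_fin A
  have e : aeval (-Aᵀ) A.charpoly = (aeval (-A) A.charpoly)ᵀ := by
    rw [← Matrix.transpose_neg]
    simp only [aeval_eq_sum_range, Matrix.transpose_sum, Matrix.transpose_smul,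
      Matrix.transpose_pow]
  have h := congrArg (fun M => |Matrix.det M|) (mul_aeval_neg_transpose_of_lyapunov A G b hG)
  simp only [Matrix.det_mul, abs_mul, e, Matrix.det_transpose, abs_det_diagonal_neg_one_pow,
    abs_det_coeffHankel _ A.charpoly_monic hdeg, mul_one] at h
  rw [h, sq]

end Lyapunov

/-! ### The Hurwitz determinant -/

section Hurwitz

open Matrix Polynomial

variable {n : ℕ}

/-- The matrix whose row `k` holds the coefficients of the even powers `x ^ (2 * m)` in
`x ^ k * p`, for `k, m < n`. -/
noncomputable def evenShiftMatrix (n : ℕ) (p : ℝ[X]) : Matrix (Fin n) (Fin n) ℝ :=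
  Matrix.of fun k m => (X ^ (k : ℕ) * p).coeff (2 * m)

/-- Up to the reversal of both index ranges, the Hurwitz matrix is `evenShiftMatrix`. -/
lemma det_hurwitzMatrix (A : Matrix (Fin n) (Fin n) ℝ) :
    (hurwitzMatrix A).det = (evenShiftMatrix n A.charpoly).det := by
  have hdeg := natDegree_charpoly_fin A
  rw [← Matrix.det_submatrix_equiv_self Fin.revPerm (evenShiftMatrix n A.charpoly)]
  congr 1
  ext i j
  simp only [hurwitzMatrix, charCoeff, evenShiftMatrix, Matrix.of_apply, Matrix.submatrix_apply,
    coeff_X_pow_mul', Fin.revPerm_apply, Fin.val_rev]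
  have hi := i.2
  have hj := j.2
  split_ifs with h1 h2 h2
  · congr 1; omega
  · omega
  · exact (coeff_eq_zero_of_natDegree_lt (by omega)).symm
  · rfl

lemma sum_range_two_mul {V : Type*} [AddCommMonoid V] (f : ℕ → V) (n : ℕ) :
    ∑ d ∈ Finset.range (2 * n), f d = ∑ l ∈ Finset.range n, (f (2 * l) + f (2 * l + 1)) := by
  induction n with
  | zero => simp
  | succ n ih =>
    rw [show 2 * (n + 1) = 2 * n + 1 + 1 by ring, Finset.sum_range_succ, Finset.sum_range_succ, ih,
      Finset.sum_range_succ, add_assoc]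

lemma aeval_add_aeval_neg (r : ℝ[X]) (hr : r.natDegree < 2 * n) (B : Matrix (Fin n) (Fin n) ℝ) :
    aeval B r + aeval (-B) r = (2 : ℝ) • ∑ l ∈ Finset.range n, r.coeff (2 * l) • B ^ (2 * l) := by
  rw [aeval_eq_sum_range' hr, aeval_eq_sum_range' hr, sum_range_two_mul, sum_range_two_mul,
    ← Finset.sum_add_distrib, Finset.smul_sum]
  refine Finset.sum_congr rfl fun l _ => ?_
  rw [(even_two_mul l).neg_pow, (odd_two_mul_add_one l).neg_pow, smul_neg, two_smul]
  abel

lemma natDegree_X_pow_mul_charpoly_le (A : Matrix (Fin n) (Fin n) ℝ) (k : ℕ) :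
    (X ^ k * A.charpoly).natDegree ≤ k + n :=
  natDegree_mul_le_of_le (natDegree_X_pow_le k) (natDegree_charpoly_fin A).le

lemma natDegree_X_pow_mul_charpoly_lt (A : Matrix (Fin n) (Fin n) ℝ) (k : Fin n) :
    (X ^ (k : ℕ) * A.charpoly).natDegree < 2 * n := by
  have := natDegree_X_pow_mul_charpoly_le A k
  omega

/-- The controllability matrix `[b, A² b, A⁴ b, …]` of the even powers. -/
noncomputable def evenControllabilityMatrix (A : Matrix (Fin n) (Fin n) ℝ) (b : Fin n → ℝ) :
    Matrix (Fin n) (Fin n) ℝ :=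
  Matrix.of fun i j => ((A ^ (2 * (j : ℕ))).mulVec b) i

/-- The even part of `x ^ k * p` evaluated at `A` is half of `(-A) ^ k p(-A)`, as `p(A) = 0`. -/
lemma two_smul_evenControllabilityMatrix_mul (A : Matrix (Fin n) (Fin n) ℝ) (b : Fin n → ℝ) :
    (2 : ℝ) • (evenControllabilityMatrix A b * (evenShiftMatrix n A.charpoly)ᵀ)
      = aeval (-A) A.charpoly * controllabilityMatrix A b *
        Matrix.diagonal fun j : Fin n => (-1 : ℝ) ^ (j : ℕ) := by
  ext i k
  have h := aeval_add_aeval_neg _ (natDegree_X_pow_mul_charpoly_lt A k) A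
  have e : aeval (-A) (X ^ (k : ℕ) * A.charpoly)
      = (-1 : ℝ) ^ (k : ℕ) • (aeval (-A) A.charpoly * A ^ (k : ℕ)) := by
    rw [mul_comm, map_mul, map_pow, aeval_X, ← neg_one_smul ℝ A, _root_.smul_pow, mul_smul_comm]
  rw [map_mul, Matrix.aeval_self_charpoly, mul_zero, zero_add, e] at h
  have h' := congrFun (congrArg (fun M => M *ᵥ b) h) i
  simp only [Matrix.smul_mulVec, Matrix.sum_mulVec, Pi.smul_apply, Finset.sum_apply,
    smul_eq_mul, ← Matrix.mulVec_mulVec, Finset.sum_range] at h'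
  rw [Matrix.mul_diagonal, Matrix.smul_apply, Matrix.mul_apply, Matrix.mul_apply, mul_comm]
  simp only [evenControllabilityMatrix, evenShiftMatrix, controllabilityMatrix, Matrix.of_apply,
    Matrix.transpose_apply, smul_eq_mul]
  simp only [Matrix.mulVec, dotProduct] at h' ⊢
  rw [h']
  congr 1
  exact Finset.sum_congr rfl fun l _ => mul_comm _ _

/-- Degrees below `2 * n`, the odd ones first and then the even ones. -/
noncomputable def oddEvenEquiv (n : ℕ) : Fin n ⊕ Fin n ≃ Fin (n + n) :=
  Equiv.ofBijective
    (Sum.elim (fun m => ⟨2 * m + 1, by omega⟩) (fun m => ⟨2 * m, by omega⟩)) <| by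
    rw [Fintype.bijective_iff_injective_and_card]
    refine ⟨?_, by simp⟩
    rintro (a | a) (b | b) h <;> simp [Fin.ext_iff] at h ⊢ <;> omega

/-- Complementary minors: with `p` the characteristic polynomial of `A`, the odd columns of
`[b, A b, …, A^{2n-1} b]` are matched with the even columns of the coefficient matrix of
`p, x p, …, x^{n-1} p`, and its first `n` columns with the last `n` columns of the latter, which
form a unitriangular matrix. -/
lemma abs_det_mul_evenControllabilityMatrix (A : Matrix (Fin n) (Fin n) ℝ) (b : Fin n → ℝ) :
    |A.det| * |(evenControllabilityMatrix A b).det|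
      = |(controllabilityMatrix A b).det| * |(evenShiftMatrix n A.charpoly).det| := by
  have hdeg := natDegree_charpoly_fin A
  -- `Z` is `[b, A b, …, A^{2n-1} b]` over the selection of the even degrees; `Y` is the selection of
  -- the degrees below `n` beside the coefficients of the `x ^ k p`. Each is block triangular
  -- for its own ordering of the degrees, and `Z * Y` is block triangular as it stands.
  let Z : Matrix (Fin n ⊕ Fin n) (Fin (n + n)) ℝ := Matrix.of <| Sum.elim
    (fun i d => (A ^ (d : ℕ) *ᵥ b) i) (fun m d => if (d : ℕ) = 2 * m then 1 else 0)
  let Y : Matrix (Fin (n + n)) (Fin n ⊕ Fin n) ℝ := Matrix.of fun d => Sum.elim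
    (fun m => if (d : ℕ) = m then 1 else 0) (fun k => (X ^ (k : ℕ) * A.charpoly).coeff d)
  have hZ : Z.submatrix id (oddEvenEquiv n) = Matrix.fromBlocks
      (A * evenControllabilityMatrix A b) (evenControllabilityMatrix A b) 0 1 := by
    ext (i | i) (j | j)
    · simp only [Z, oddEvenEquiv, Matrix.submatrix_apply, Equiv.ofBijective_apply, Sum.elim_inl,
        Matrix.of_apply, id_eq, pow_succ', ← Matrix.mulVec_mulVec, Matrix.fromBlocks_apply₁₁]
      rfl
    · simp [Z, oddEvenEquiv, evenControllabilityMatrix]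
    · simp [Z, oddEvenEquiv]
      omega
    · simp [Z, oddEvenEquiv, Matrix.one_apply, Fin.ext_iff, eq_comm]
  let W : Matrix (Fin n) (Fin n) ℝ := Matrix.of fun m k => (X ^ (k : ℕ) * A.charpoly).coeff (n + m)
  let V : Matrix (Fin n) (Fin n) ℝ := Matrix.of fun m k => (X ^ (k : ℕ) * A.charpoly).coeff m
  have hY : Y.submatrix finSumFinEquiv id = Matrix.fromBlocks 1 V 0 W := by
    ext (i | i) (j | j)
    · simp [Y, Matrix.one_apply, Fin.ext_iff]
    · simp [Y, V]
    · simp [Y]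
      omega
    · simp [Y, W, add_comm]
  have hW : W.det = 1 := by
    rw [Matrix.det_of_isUpperTriangular]
    · refine Finset.prod_eq_one fun i _ => ?_
      simp only [W, Matrix.of_apply, coeff_X_pow_mul']
      rw [if_pos (by omega), show n + (i : ℕ) - i = A.charpoly.natDegree by omega]
      exact A.charpoly_monic
    · intro i j hij
      have hij' : (j : ℕ) < i := hij
      have hdeg' := natDegree_X_pow_mul_charpoly_le A j
      have : (X ^ (j : ℕ) * A.charpoly).coeff (n + i) = 0 :=
        coeff_eq_zero_of_natDegree_lt (by omega)
      exact this
  have hZY : ∃ U, Z * Y = Matrix.fromBlocks (controllabilityMatrix A b) 0 U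
      (evenShiftMatrix n A.charpoly)ᵀ := by
    refine ⟨(Z * Y).toBlocks₂₁, ?_⟩
    ext (i | i) (j | j)
    · simp only [Matrix.mul_apply, Z, Y, Matrix.of_apply, Sum.elim_inl, Matrix.fromBlocks_apply₁₁,
        controllabilityMatrix, mul_ite, mul_one, mul_zero]
      rw [Finset.sum_eq_single (Fin.castAdd n j)]
      · simp
      · intro d _ hd
        rw [if_neg]
        simpa [Fin.ext_iff] using hd
      · simp
    · simp only [Matrix.mul_apply, Z, Y, Matrix.of_apply, Sum.elim_inl, Sum.elim_inr,
        Matrix.fromBlocks_apply₁₂, Matrix.zero_apply]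
      have h : aeval A (X ^ (j : ℕ) * A.charpoly) = 0 := by
        rw [map_mul, Matrix.aeval_self_charpoly, mul_zero]
      rw [aeval_eq_sum_range' (n := n + n)
        ((natDegree_X_pow_mul_charpoly_lt A j).trans_eq (two_mul n)), Finset.sum_range] at h
      have h' := congrFun (congrArg (fun M => M *ᵥ b) h) i
      simp only [Matrix.smul_mulVec, Matrix.sum_mulVec, Pi.smul_apply, Finset.sum_apply,
        smul_eq_mul, Matrix.zero_mulVec, Pi.zero_apply] at h'
      rw [← h']
      exact Finset.sum_congr rfl fun l _ => mul_comm _ _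
    · rfl
    · simp only [Matrix.mul_apply, Z, Y, Matrix.of_apply, Sum.elim_inr,
        Matrix.fromBlocks_apply₂₂, evenShiftMatrix, ite_mul, one_mul, zero_mul,
        Matrix.transpose_apply]
      rw [Finset.sum_eq_single ⟨2 * i, by omega⟩]
      · simp
      · intro d _ hd
        rw [if_neg]
        simpa [Fin.ext_iff] using hd
      · simp
  obtain ⟨U, hU⟩ := hZY
  have h1 : |(Z * Y).det| = |(Z.submatrix id (oddEvenEquiv n)).det|
      * |(Y.submatrix finSumFinEquiv id).det| := by
    have e : Y.submatrix (oddEvenEquiv n) id = (Y.submatrix finSumFinEquiv id).submatrix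
        ((oddEvenEquiv n).trans finSumFinEquiv.symm) (Equiv.refl _) := by
      ext i j
      simp
    rw [← Matrix.abs_det_submatrix_equiv_equiv
      ((oddEvenEquiv n).trans finSumFinEquiv.symm) (Equiv.refl _) (Y.submatrix finSumFinEquiv id),
      ← e, ← abs_mul, ← Matrix.det_mul, Matrix.submatrix_mul_equiv]
    rfl
  rw [hU, hZ, hY, Matrix.det_fromBlocks_zero₁₂, Matrix.det_fromBlocks_zero₂₁,
    Matrix.det_fromBlocks_zero₂₁, hW, Matrix.det_transpose] at h1
  simp only [Matrix.det_mul, Matrix.det_one, mul_one, abs_mul, abs_one] at h1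
  exact h1.symm

lemma two_pow_mul_sq_det_hurwitzMatrix (A : Matrix (Fin n) (Fin n) ℝ) (b : Fin n → ℝ)
    (hC : (controllabilityMatrix A b).det ≠ 0) :
    2 ^ n * |(hurwitzMatrix A).det| ^ 2 = |A.det| * |(aeval (-A) A.charpoly).det| := by
  have h1 := congrArg (fun M => |Matrix.det M|) (two_smul_evenControllabilityMatrix_mul A b)
  simp only [Matrix.det_smul, Matrix.det_mul, abs_mul, Matrix.det_transpose, Fintype.card_fin,
    abs_det_diagonal_neg_one_pow, mul_one, abs_pow, abs_two] at h1
  have h2 := abs_det_mul_evenControllabilityMatrix A b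
  rw [det_hurwitzMatrix]
  apply mul_right_cancel₀ (abs_ne_zero.mpr hC)
  linear_combination (-(2 ^ n * |(evenShiftMatrix n A.charpoly).det|)) * h2 + |A.det| * h1

end Hurwitz

/-! ### The transformation to the controllable canonical form -/

section CanonicalForm

open Matrix

variable {n : ℕ}

lemma ccfRow_dotProduct (A : Matrix (Fin n) (Fin n) ℝ) (b : Fin n → ℝ)
    (hC : (controllabilityMatrix A b).det ≠ 0) (j : Fin n) :
    ccfRow A b ⬝ᵥ (A ^ (j : ℕ) *ᵥ b) = if (j : ℕ) + 1 = n then 1 else 0 := by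
  have h : ccfRow A b ᵥ* controllabilityMatrix A b
      = fun i : Fin n => if (i : ℕ) + 1 = n then (1 : ℝ) else 0 := by
    rw [ccfRow, Matrix.vecMul_vecMul, Matrix.nonsing_inv_mul _ (isUnit_iff_ne_zero.mpr hC),
      Matrix.vecMul_one]
  exact congrFun h j

/-- The product of the two matrices has entries `w₁ A ^ (i + j) b`, so it is antitriangular. -/
lemma abs_det_ccfInverseTransformation (A : Matrix (Fin n) (Fin n) ℝ) (b : Fin n → ℝ)
    (hC : (controllabilityMatrix A b).det ≠ 0) :
    |(ccfInverseTransformation A b).det| * |(controllabilityMatrix A b).det| = 1 := by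
  rw [← abs_mul, ← Matrix.det_mul]
  have e : ∀ i j : Fin n, (ccfInverseTransformation A b * controllabilityMatrix A b) i j
      = ccfRow A b ⬝ᵥ (A ^ ((i : ℕ) + j) *ᵥ b) := by
    intro i j
    rw [pow_add, ← Matrix.mulVec_mulVec, Matrix.dotProduct_mulVec]
    rfl
  apply abs_det_eq_one_of_antitriangular
  · intro i j h
    have := ccfRow_dotProduct A b hC ⟨i + j, by omega⟩
    rw [e, this, if_neg]
    simp only
    omega
  · intro i j h
    have := ccfRow_dotProduct A b hC ⟨i + j, by omega⟩
    rw [e, this, if_pos h]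

lemma charCoeff_self (A : Matrix (Fin n) (Fin n) ℝ) :
    charCoeff A (n : ℤ) = A.charpoly.coeff 0 := by
  simp [charCoeff]

end CanonicalForm

/-! ### Trajectories of the linear system and the Gramian -/

section Flow

open Matrix

variable {n : ℕ}

/-- The free motion `t ↦ e^{tA} v`. -/
noncomputable def flow (A : Matrix (Fin n) (Fin n) ℝ) (v : Fin n → ℝ) (t : ℝ) : Fin n → ℝ :=
  (NormedSpace.exp (t • A)).mulVec v

open scoped Matrix.Norms.Operator in
lemma hasDerivAt_exp_smul_mul (A : Matrix (Fin n) (Fin n) ℝ) (t : ℝ) :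
    HasDerivAt (fun s : ℝ => NormedSpace.exp (s • A)) (NormedSpace.exp (t • A) * A) t :=
  hasDerivAt_exp_smul_const A t

open scoped Matrix.Norms.Operator in
lemma exp_smul_mul_comm (A : Matrix (Fin n) (Fin n) ℝ) (t : ℝ) :
    NormedSpace.exp (t • A) * A = A * NormedSpace.exp (t • A) :=
  (hasDerivAt_exp_smul_const A t).unique (hasDerivAt_exp_smul_const' A t)

lemma flow_mulVec (A : Matrix (Fin n) (Fin n) ℝ) (v : Fin n → ℝ) (t : ℝ) :
    flow A (A *ᵥ v) t = A *ᵥ flow A v t := by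
  simp only [flow, Matrix.mulVec_mulVec, exp_smul_mul_comm]

lemma flow_sub (A : Matrix (Fin n) (Fin n) ℝ) (v w : Fin n → ℝ) (t : ℝ) :
    flow A (v - w) t = flow A v t - flow A w t := Matrix.mulVec_sub _ _ _

lemma flow_smul (A : Matrix (Fin n) (Fin n) ℝ) (c : ℝ) (v : Fin n → ℝ) (t : ℝ) :
    flow A (c • v) t = c • flow A v t := Matrix.mulVec_smul _ _ _

lemma flow_zero_right (A : Matrix (Fin n) (Fin n) ℝ) (v : Fin n → ℝ) : flow A v 0 = v := by
  simp [flow]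

open scoped Matrix.Norms.Operator in
lemma hasDerivAt_flow (A : Matrix (Fin n) (Fin n) ℝ) (v : Fin n → ℝ) (t : ℝ) :
    HasDerivAt (flow A v) (A *ᵥ flow A v t) t := by
  have h := hasDerivAt_exp_smul_mul A t
  let L : Matrix (Fin n) (Fin n) ℝ →L[ℝ] (Fin n → ℝ) :=
    LinearMap.toContinuousLinearMap ((Matrix.mulVecBilin ℝ ℝ).flip v)
  have h2 := L.hasFDerivAt.comp_hasDerivAt t h
  have e : L (NormedSpace.exp (t • A) * A) = A *ᵥ flow A v t := by
    rw [exp_smul_mul_comm]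
    exact (Matrix.mulVec_mulVec v A (NormedSpace.exp (t • A))).symm
  exact h2.congr_deriv e

lemma continuous_flow (A : Matrix (Fin n) (Fin n) ℝ) (v : Fin n → ℝ) : Continuous (flow A v) :=
  continuous_iff_continuousAt.mpr fun t => (hasDerivAt_flow A v t).continuousAt

/-- If `w` annihilates every `A ^ k v`, it annihilates the whole trajectory through `v`. -/
lemma dotProduct_flow_eq_zero (A : Matrix (Fin n) (Fin n) ℝ) (v w : Fin n → ℝ)
    (h : ∀ k : ℕ, w ⬝ᵥ (A ^ k *ᵥ v) = 0) (t : ℝ) : w ⬝ᵥ flow A v t = 0 := by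
  have hs := open scoped Matrix.Norms.Operator in
    NormedSpace.exp_series_hasSum_exp' (𝕂 := ℝ) (t • A)
  let L : Matrix (Fin n) (Fin n) ℝ →ₗ[ℝ] ℝ :=
    { toFun := fun M => w ⬝ᵥ (M *ᵥ v)
      map_add' := fun M N => by rw [Matrix.add_mulVec, dotProduct_add]
      map_smul' := fun c M => by rw [Matrix.smul_mulVec, dotProduct_smul]; rfl }
  have h2 := hs.mapL (LinearMap.toContinuousLinearMap L)
  have hL : ∀ k : ℕ, L ((k.factorial : ℝ)⁻¹ • (t • A) ^ k) = 0 := by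
    intro k
    change w ⬝ᵥ (((k.factorial : ℝ)⁻¹ • (t • A) ^ k) *ᵥ v) = 0
    rw [smul_pow, Matrix.smul_mulVec, Matrix.smul_mulVec, dotProduct_smul, dotProduct_smul, h,
      smul_zero, smul_zero]
  have hz : HasSum (fun k : ℕ => L ((k.factorial : ℝ)⁻¹ • (t • A) ^ k)) 0 := by
    simp only [hL]
    exact hasSum_zero
  exact h2.unique hz

/-- A vector orthogonal to `b, A b, …, A^{n-1} b` is orthogonal to every `A ^ k b`. -/
lemma dotProduct_pow_mulVec_eq_zero (A : Matrix (Fin n) (Fin n) ℝ) (b w : Fin n → ℝ)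
    (h : w ᵥ* controllabilityMatrix A b = 0) (k : ℕ) : w ⬝ᵥ (A ^ k *ᵥ b) = 0 := by
  rcases Nat.eq_zero_or_pos n with rfl | hn
  · simp
  have hlt : (Polynomial.X ^ k %ₘ A.charpoly).natDegree < n := by
    -- `Polynomial.natDegree_modByMonic_lt` fails for the divisor `1`, excluded here by `0 < n`.
    have h1 : A.charpoly ≠ 1 := by
      intro h1
      have := A.charpoly_natDegree_eq_dim
      rw [h1] at this
      simp at this
      omega
    have := Polynomial.natDegree_modByMonic_lt (Polynomial.X ^ k) A.charpoly_monic h1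
    simpa using this
  rw [Matrix.pow_eq_aeval_mod_charpoly, Polynomial.aeval_eq_sum_range' hlt, Matrix.sum_mulVec,
    dotProduct_sum]
  refine Finset.sum_eq_zero fun i hi => ?_
  have hi' : w ⬝ᵥ (A ^ i *ᵥ b) = 0 := congrFun h ⟨i, Finset.mem_range.mp hi⟩
  rw [Matrix.smul_mulVec, dotProduct_smul, hi', smul_zero]

lemma HasDerivWithinAt.dotProduct {x y : ℝ → Fin n → ℝ} {x' y' : Fin n → ℝ} {s : Set ℝ} {t : ℝ}
    (hx : HasDerivWithinAt x x' s t) (hy : HasDerivWithinAt y y' s t) :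
    HasDerivWithinAt (fun t => x t ⬝ᵥ y t) (x' ⬝ᵥ y t + x t ⬝ᵥ y') s t := by
  simp only [_root_.dotProduct, ← Finset.sum_add_distrib]
  rw [hasDerivWithinAt_pi] at hx hy
  exact HasDerivWithinAt.fun_sum fun i _ => (hx i).mul (hy i)

/-- Kalman's rank condition is necessary: if `w` is orthogonal to all `A ^ k b`, then
`w ⬝ e^{(T-t)A} x(t)` is constant along every trajectory, so the origin cannot be steered
to `w`. -/
lemma det_controllabilityMatrix_ne_zero {A : Matrix (Fin n) (Fin n) ℝ} {b : Fin n → ℝ}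
    (h : StateControllable A b) : (controllabilityMatrix A b).det ≠ 0 := by
  intro hdet
  obtain ⟨w, hw0, hw⟩ := Matrix.exists_vecMul_eq_zero_iff.mpr hdet
  obtain ⟨T, hT, u, x, -, hx, hx0, hxT⟩ := h 0 w
  have hb : ∀ t, flow Aᵀ w t ⬝ᵥ b = 0 := by
    intro t
    rw [dotProduct_comm]
    refine dotProduct_flow_eq_zero _ _ _ (fun k => ?_) t
    rw [← Matrix.transpose_pow, Matrix.mulVec_transpose, dotProduct_comm,
      ← Matrix.dotProduct_mulVec]
    exact dotProduct_pow_mulVec_eq_zero A b w hw k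
  have hderiv : ∀ t ∈ Icc 0 T,
      HasDerivWithinAt (fun t => flow Aᵀ w (T - t) ⬝ᵥ x t) 0 (Icc 0 T) t := by
    intro t ht
    have h1 : HasDerivAt (fun t => flow Aᵀ w (T - t)) (-(Aᵀ *ᵥ flow Aᵀ w (T - t))) t := by
      exact ((hasDerivAt_flow Aᵀ w (T - t)).scomp t ((hasDerivAt_id t).const_sub T)).congr_deriv
        (neg_one_smul ℝ _)
    refine (h1.hasDerivWithinAt.dotProduct (hx t ht)).congr_deriv ?_
    rw [dotProduct_add, dotProduct_smul, hb, smul_zero, add_zero, neg_dotProduct,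
      Matrix.mulVec_transpose, ← Matrix.dotProduct_mulVec, neg_add_cancel]
  have hconst := constant_of_has_deriv_right_zero
    (fun t ht => (hderiv t ht).continuousWithinAt)
    (fun t ht => (hderiv t (Ico_subset_Icc_self ht)).mono_of_mem_nhdsWithin
      (Icc_mem_nhdsGE_of_mem ht)) T (right_mem_Icc.mpr hT.le)
  rw [sub_self, flow_zero_right, hxT, hx0, dotProduct_zero] at hconst
  exact hw0 (dotProduct_self_eq_zero.mp hconst)

/-- One step of the decay estimate: `x = e^{tA} v` solves `x' = r x + e^{tA} (A - r) v`, so it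
decays exponentially as soon as the inhomogeneity does and `r < 0`. -/
lemma exists_norm_flow_le_step (A : Matrix (Fin n) (Fin n) ℝ) (v : Fin n → ℝ) {r : ℝ} (hr : r < 0)
    {K c : ℝ} (hc : 0 < c)
    (h : ∀ t, 0 ≤ t → ‖flow A (A *ᵥ v - r • v) t‖ ≤ K * Real.exp (-c * t)) :
    ∃ K' c' : ℝ, 0 < c' ∧ ∀ t, 0 ≤ t → ‖flow A v t‖ ≤ K' * Real.exp (-c' * t) := by
  have hK : 0 ≤ K := by
    have := (norm_nonneg _).trans (h 0 le_rfl)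
    simpa using this
  -- A rate strictly below both `c` and `-r` rules out resonance.
  obtain ⟨d, hd0, hdc, hdr⟩ : ∃ d, 0 < d ∧ d ≤ c ∧ 0 < -r - d :=
    ⟨min c (-r / 2), lt_min hc (by linarith), min_le_left _ _, by
      have := min_le_right c (-r / 2)
      linarith⟩
  refine ⟨‖v‖ + K / (-r - d), d, hd0, fun t ht => ?_⟩
  have hy : ∀ s, HasDerivAt (fun s => Real.exp (-r * s) • flow A v s)
      (Real.exp (-r * s) • flow A (A *ᵥ v - r • v) s) s := by
    intro s
    have h1 : HasDerivAt (fun s => Real.exp (-r * s)) (Real.exp (-r * s) * (-r)) s := by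
      simpa using ((hasDerivAt_id s).const_mul (-r)).exp
    refine (h1.smul (hasDerivAt_flow A v s)).congr_deriv ?_
    rw [flow_sub, flow_smul, flow_mulVec]
    module
  have hB : ∀ s, HasDerivAt (fun s => ‖v‖ + K / (-r - d) * (Real.exp ((-r - d) * s)))
      (K * Real.exp ((-r - d) * s)) s := by
    intro s
    have h1 : HasDerivAt (fun s => Real.exp ((-r - d) * s))
        (Real.exp ((-r - d) * s) * (-r - d)) s := by
      simpa using ((hasDerivAt_id s).const_mul (-r - d)).exp
    refine ((h1.const_mul (K / (-r - d))).const_add ‖v‖).congr_deriv ?_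
    field_simp
  have key := image_norm_le_of_norm_deriv_right_le_deriv_boundary (a := 0) (b := t)
    (fun s _ => (hy s).continuousAt.continuousWithinAt)
    (fun s _ => (hy s).hasDerivWithinAt) (B := fun s => ‖v‖ + K / (-r - d) *
      (Real.exp ((-r - d) * s))) ?_ hB ?_ (right_mem_Icc.mpr ht)
  · rw [norm_smul, Real.norm_eq_abs, Real.abs_exp] at key
    have e1 : ‖flow A v t‖ = Real.exp (r * t) * (Real.exp (-r * t) * ‖flow A v t‖) := by
      rw [← mul_assoc, ← Real.exp_add]
      simp
    have e2 : Real.exp (r * t) * Real.exp ((-r - d) * t) = Real.exp (-d * t) := by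
      rw [← Real.exp_add]
      congr 1
      ring
    have e3 : Real.exp (r * t) ≤ Real.exp (-d * t) :=
      Real.exp_le_exp.mpr (by nlinarith)
    calc ‖flow A v t‖ = Real.exp (r * t) * (Real.exp (-r * t) * ‖flow A v t‖) := e1
      _ ≤ Real.exp (r * t) * (‖v‖ + K / (-r - d) * (Real.exp ((-r - d) * t))) := by gcongr
      _ = ‖v‖ * Real.exp (r * t) + K / (-r - d) * Real.exp (-d * t) := by rw [← e2]; ring
      _ ≤ ‖v‖ * Real.exp (-d * t) + K / (-r - d) * Real.exp (-d * t) := by gcongr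
      _ = _ := by ring
  · simp only [mul_zero, Real.exp_zero, one_smul, flow_zero_right, mul_one]
    have : 0 ≤ K / (-r - d) := by positivity
    linarith
  · intro s hs
    rw [norm_smul, Real.norm_eq_abs, Real.abs_exp]
    calc Real.exp (-r * s) * ‖flow A (A *ᵥ v - r • v) s‖
        ≤ Real.exp (-r * s) * (K * Real.exp (-d * s)) := by
          gcongr
          refine (h s hs.1).trans ?_
          gcongr
          exact hs.1
      _ = K * (Real.exp (-r * s) * Real.exp (-d * s)) := by ring
      _ = K * Real.exp ((-r - d) * s) := by
          rw [← Real.exp_add]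
          congr 2
          ring

/-- Exponential decay of `e^{tA} v` when `v` is annihilated by a product of factors `A - r` with
`r < 0`, by removing one factor at a time; repeated `r` need no separate treatment. -/
lemma exists_norm_flow_le_of_prod (A : Matrix (Fin n) (Fin n) ℝ) (s : Multiset ℝ)
    (hs : ∀ r ∈ s, r < 0) (v : Fin n → ℝ)
    (hv : Polynomial.aeval A (s.map fun r => Polynomial.X - Polynomial.C r).prod *ᵥ v = 0) :
    ∃ K c : ℝ, 0 < c ∧ ∀ t, 0 ≤ t → ‖flow A v t‖ ≤ K * Real.exp (-c * t) := by
  induction s using Multiset.induction_on generalizing v with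
  | empty =>
    have hv0 : v = 0 := by simpa using hv
    exact ⟨0, 1, one_pos, fun t _ => by simp [hv0, flow]⟩
  | cons r s ih =>
    obtain ⟨K, c, hc, h⟩ := ih (fun r' hr' => hs r' (Multiset.mem_cons_of_mem hr'))
      (A *ᵥ v - r • v) (by
        rw [Multiset.map_cons, Multiset.prod_cons, mul_comm, map_mul, ← Matrix.mulVec_mulVec] at hv
        rw [← hv]
        congr 1
        simp [Matrix.sub_mulVec, Algebra.algebraMap_eq_smul_one, Matrix.smul_mulVec])
    exact exists_norm_flow_le_step A v (hs r (Multiset.mem_cons_self r s)) hc h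

open Polynomial in
lemma exists_charpoly_eq_prod {A : Matrix (Fin n) (Fin n) ℝ} (h : HasNegativeRealEigenvalues A) :
    ∃ s : Multiset ℝ, (∀ r ∈ s, r < 0) ∧
      A.charpoly = (s.map fun r => Polynomial.X - Polynomial.C r).prod := by
  set q : ℂ[X] := A.charpoly.map (algebraMap ℝ ℂ) with hq
  have hroot : ∀ μ ∈ q.roots, ∃ r : ℝ, r < 0 ∧ μ = (r : ℂ) := by
    intro μ hμ
    apply h
    rw [Module.End.hasEigenvalue_iff_isRoot_charpoly, Matrix.charpoly_toLin', Matrix.charpoly_map]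
    exact isRoot_of_mem_roots hμ
  have hre : ∀ μ ∈ q.roots, ((μ.re : ℝ) : ℂ) = μ := by
    intro μ hμ
    obtain ⟨r, -, rfl⟩ := hroot μ hμ
    simp
  refine ⟨q.roots.map Complex.re, ?_, ?_⟩
  · intro r hr
    obtain ⟨μ, hμ, rfl⟩ := Multiset.mem_map.mp hr
    obtain ⟨r', hr', rfl⟩ := hroot μ hμ
    exact hr'
  · apply Polynomial.map_injective (algebraMap ℝ ℂ) Complex.ofReal_injective
    rw [← hq, (IsAlgClosed.splits q).eq_prod_roots_of_monic (A.charpoly_monic.map _),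
      Polynomial.map_multiset_prod, Multiset.map_map, Multiset.map_map]
    congr 1
    refine Multiset.map_congr ?_ fun μ hμ => ?_
    · rw [← (IsAlgClosed.splits q).eq_prod_roots_of_monic (A.charpoly_monic.map _)]
    · simp only [Function.comp_apply, Polynomial.map_sub, Polynomial.map_X, Polynomial.map_C]
      rw [← (IsAlgClosed.splits q).eq_prod_roots_of_monic (A.charpoly_monic.map _)] at hμ
      rw [Complex.coe_algebraMap, hre μ hμ]

lemma charpoly_coeff_zero_pos {A : Matrix (Fin n) (Fin n) ℝ} (h : HasNegativeRealEigenvalues A) :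
    0 < A.charpoly.coeff 0 := by
  obtain ⟨s, hs, hp⟩ := exists_charpoly_eq_prod h
  rw [Polynomial.coeff_zero_eq_eval_zero, hp, Polynomial.eval_multiset_prod, Multiset.map_map]
  refine Multiset.prod_pos fun x hx => ?_
  obtain ⟨r, hr, rfl⟩ := Multiset.mem_map.mp hx
  simpa using hs r hr

lemma exists_norm_flow_le {A : Matrix (Fin n) (Fin n) ℝ} (h : HasNegativeRealEigenvalues A)
    (v : Fin n → ℝ) :
    ∃ K c : ℝ, 0 < c ∧ ∀ t, 0 ≤ t → ‖flow A v t‖ ≤ K * Real.exp (-c * t) := by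
  obtain ⟨s, hs, hp⟩ := exists_charpoly_eq_prod h
  exact exists_norm_flow_le_of_prod A s hs v
    (by rw [← hp, Matrix.aeval_self_charpoly, Matrix.zero_mulVec])

lemma memLp_flow {A : Matrix (Fin n) (Fin n) ℝ} (h : HasNegativeRealEigenvalues A)
    (v : Fin n → ℝ) (i : Fin n) :
    MemLp (fun t => flow A v t i) 2 (volume.restrict (Ioi (0 : ℝ))) := by
  obtain ⟨K, c, hc, hK⟩ := exists_norm_flow_le h v
  have hcont : Continuous fun t => flow A v t i := (continuous_apply i).comp (continuous_flow A v)
  rw [memLp_two_iff_integrable_sq hcont.aestronglyMeasurable]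
  refine Integrable.mono' ((exp_neg_integrableOn_Ioi 0 (mul_pos two_pos hc)).const_mul (K ^ 2))
    (hcont.pow 2).aestronglyMeasurable ?_
  filter_upwards [ae_restrict_mem measurableSet_Ioi] with t ht
  have h1 : |flow A v t i| ≤ K * Real.exp (-c * t) :=
    (norm_le_pi_norm (flow A v t) i).trans (hK t (le_of_lt ht))
  rw [Real.norm_eq_abs, abs_pow]
  calc |flow A v t i| ^ 2 ≤ (K * Real.exp (-c * t)) ^ 2 := by gcongr
    _ = K ^ 2 * Real.exp (-(2 * c) * t) := by
      rw [mul_pow, ← Real.exp_nat_mul]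
      congr 2
      push_cast
      ring

lemma tendsto_flow {A : Matrix (Fin n) (Fin n) ℝ} (h : HasNegativeRealEigenvalues A)
    (v : Fin n → ℝ) : Filter.Tendsto (flow A v) Filter.atTop (nhds 0) := by
  obtain ⟨K, c, hc, hK⟩ := exists_norm_flow_le h v
  refine squeeze_zero_norm' (a := fun t => K * Real.exp (-c * t)) ?_ ?_
  · filter_upwards [Filter.eventually_ge_atTop 0] with t ht using hK t ht
  · have : Filter.Tendsto (fun t : ℝ => Real.exp (-c * t)) Filter.atTop (nhds 0) :=
      Real.tendsto_exp_atBot.comp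
        (Filter.tendsto_id.const_mul_atTop_of_neg (by linarith))
    simpa using this.const_mul K

/-- The Gramian `∫₀^∞ e^{tA} b bᵀ e^{tAᵀ} dt`. -/
noncomputable def gramian (A : Matrix (Fin n) (Fin n) ℝ) (b : Fin n → ℝ) :
    Matrix (Fin n) (Fin n) ℝ :=
  Matrix.of fun i j => ∫ t in Ioi (0 : ℝ), flow A b t i * flow A b t j

/-- Integrate the derivative of `φ φᵀ`, where `φ t = e^{tA} b`, over `(0, ∞)`. -/
lemma lyapunov_gramian {A : Matrix (Fin n) (Fin n) ℝ} (h : HasNegativeRealEigenvalues A)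
    (b : Fin n → ℝ) :
    A * gramian A b + gramian A b * Aᵀ = -Matrix.vecMulVec b b := by
  have hint : ∀ i j, Integrable (fun t => flow A b t i * flow A b t j)
      (volume.restrict (Ioi (0 : ℝ))) := fun i j =>
    (memLp_flow h b i).integrable_mul (memLp_flow h b j)
  ext i j
  have hd : ∀ t, HasDerivAt (fun t => flow A b t i * flow A b t j)
      ((∑ k, A i k * (flow A b t k * flow A b t j))
        + ∑ k, (flow A b t i * flow A b t k) * A j k) t := by
    intro t
    have h1 := hasDerivAt_pi.mp (hasDerivAt_flow A b t)
    refine ((h1 i).mul (h1 j)).congr_deriv ?_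
    simp only [Matrix.mulVec, _root_.dotProduct, Finset.sum_mul, Finset.mul_sum]
    congr 1 <;> exact Finset.sum_congr rfl fun k _ => by ring
  have hi1 : Integrable (fun t => ∑ k, A i k * (flow A b t k * flow A b t j))
      (volume.restrict (Ioi (0 : ℝ))) :=
    integrable_finsetSum _ fun k _ => (hint k j).const_mul _
  have hi2 : Integrable (fun t => ∑ k, (flow A b t i * flow A b t k) * A j k)
      (volume.restrict (Ioi (0 : ℝ))) :=
    integrable_finsetSum _ fun k _ => (hint i k).mul_const _
  have hlim : Filter.Tendsto (fun t => flow A b t i * flow A b t j) Filter.atTop (nhds 0) := by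
    have := tendsto_pi_nhds.mp (tendsto_flow h b)
    simpa using (this i).mul (this j)
  have key := integral_Ioi_of_hasDerivAt_of_tendsto
    (hd 0).continuousAt.continuousWithinAt (fun t _ => hd t) (hi1.add hi2) hlim
  rw [integral_add hi1 hi2, integral_finsetSum _ fun k _ => (hint k j).const_mul _,
    integral_finsetSum _ fun k _ => (hint i k).mul_const _] at key
  simp only [integral_const_mul, integral_mul_const, flow_zero_right, zero_sub] at key
  simpa only [Matrix.add_apply, Matrix.mul_apply, Matrix.neg_apply, Matrix.vecMulVec_apply,
    Matrix.transpose_apply, gramian, Matrix.of_apply] using key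

end Flow

/-! ### The image of the unit ball of `L²` -/

section Ellipsoid

open Matrix

variable {n : ℕ}

lemma volume_sum_sq_le_one (n : ℕ) :
    volume {c : Fin n → ℝ | ∑ i, c i ^ 2 ≤ 1} = ENNReal.ofReal (ballCoeff n) := by
  rcases Nat.eq_zero_or_pos n with rfl | hn
  · have : {c : Fin 0 → ℝ | ∑ i, c i ^ 2 ≤ 1} = univ := by
      ext c
      simp
    rw [this, Measure.volume_pi_eq_dirac]
    simp [ballCoeff]
  · have : Nonempty (Fin n) := ⟨⟨0, hn⟩⟩
    have h := EuclideanSpace.volume_closedBall (Fin n) 0 1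
    rw [← (PiLp.volume_preserving_toLp (Fin n)).measure_preimage
      Metric.isClosed_closedBall.measurableSet.nullMeasurableSet] at h
    convert h using 2
    · ext c
      simp [EuclideanSpace.norm_eq]
    · simp [ballCoeff, Real.sqrt_eq_rpow, ← Real.rpow_mul_natCast Real.pi_nonneg]
      ring_nf

lemma eLpNorm_two_le_one_iff {α : Type*} [MeasurableSpace α] {μ : Measure α} {z : α → ℝ}
    (hz : MemLp z 2 μ) : eLpNorm z 2 μ ≤ 1 ↔ ∫ t, z t ^ 2 ∂μ ≤ 1 := by
  have h0 : 0 ≤ ∫ t, z t ^ 2 ∂μ := integral_nonneg fun t => sq_nonneg _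
  rw [hz.eLpNorm_eq_integral_rpow_norm (by simp) (by simp), ENNReal.ofReal_le_one]
  simp only [ENNReal.toReal_ofNat, Real.rpow_two, Real.norm_eq_abs, sq_abs]
  rw [Real.rpow_inv_le_iff_of_pos h0 zero_le_one two_pos, Real.one_rpow]

lemma integral_sum_mul_sum {α : Type*} [MeasurableSpace α] {μ : Measure α} {φ : α → Fin n → ℝ}
    (hφ : ∀ i, MemLp (fun t => φ t i) 2 μ) (c d : Fin n → ℝ) :
    ∫ t, (∑ i, c i * φ t i) * (∑ j, d j * φ t j) ∂μ
      = ∑ i, ∑ j, c i * d j * ∫ t, φ t i * φ t j ∂μ := by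
  have hint : ∀ i j, Integrable (fun t => c i * d j * (φ t i * φ t j)) μ := fun i j =>
    ((hφ i).integrable_mul (hφ j)).const_mul _
  simp only [← integral_const_mul]
  rw [Finset.sum_congr rfl fun i _ => (integral_finsetSum _ fun j _ => hint i j).symm,
    ← integral_finsetSum _ fun i _ => integrable_finsetSum _ fun j _ => hint i j]
  refine integral_congr_ae (Filter.Eventually.of_forall fun t => ?_)
  simp only [Finset.sum_mul_sum]
  exact Finset.sum_congr rfl fun i _ => Finset.sum_congr rfl fun j _ => by ring

/-- The volume of the image of the unit ball of `L²` under `z ↦ ∫ z φ`: with a factorization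
`G = S Sᵀ` of the Gram matrix of `φ`, the components of `ψ = S⁻¹ φ` are orthonormal, so that
this image is `S` applied to the Euclidean unit ball (Bessel's inequality). -/
lemma volume_image_unitBall {α : Type*} [MeasurableSpace α] {μ : Measure α} (φ : α → Fin n → ℝ)
    (hφ : ∀ i, MemLp (fun t => φ t i) 2 μ) (G : Matrix (Fin n) (Fin n) ℝ)
    (hG : ∀ i j, G i j = ∫ t, φ t i * φ t j ∂μ) (hdet : G.det ≠ 0) :
    volume {x : Fin n → ℝ | ∃ z : α → ℝ, MemLp z 2 μ ∧ eLpNorm z 2 μ ≤ 1 ∧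
        Integrable (fun t => z t • φ t) μ ∧ x = ∫ t, z t • φ t ∂μ}
      = ENNReal.ofReal (ballCoeff n * √|G.det|) := by
  have hpsd : G.PosSemidef := by
    refine Matrix.posSemidef_iff_dotProduct_mulVec.mpr ⟨?_, fun x => ?_⟩
    · ext i j
      simp only [Matrix.conjTranspose_apply, star_trivial, hG, mul_comm]
    · have e : star x ⬝ᵥ (G *ᵥ x) = ∫ t, (∑ i, x i * φ t i) ^ 2 ∂μ := by
        simp only [sq]
        rw [integral_sum_mul_sum hφ]
        simp only [star_trivial, Matrix.mulVec, dotProduct, hG, Finset.mul_sum]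
        exact Finset.sum_congr rfl fun i _ => Finset.sum_congr rfl fun j _ => by ring
      rw [e]
      exact integral_nonneg fun t => sq_nonneg _
  obtain ⟨B, hB⟩ : ∃ B : Matrix (Fin n) (Fin n) ℝ, G = star B * B := by
    open scoped MatrixOrder in
    exact CStarAlgebra.nonneg_iff_eq_star_mul_self.mp (Matrix.nonneg_iff_posSemidef.mpr hpsd)
  obtain ⟨S, hS⟩ : ∃ S : Matrix (Fin n) (Fin n) ℝ, G = S * Sᵀ := ⟨Bᵀ, by
    rw [hB, Matrix.transpose_transpose, Matrix.star_eq_conjTranspose,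
      Matrix.conjTranspose_eq_transpose_of_trivial]⟩
  have hdetG : G.det = S.det ^ 2 := by rw [hS, Matrix.det_mul, Matrix.det_transpose, sq]
  have hSdet : IsUnit S.det := isUnit_iff_ne_zero.mpr fun h => hdet (by rw [hdetG, h]; simp)
  set ψ : α → Fin n → ℝ := fun t => S⁻¹ *ᵥ φ t with hψ
  have hφψ : ∀ t, φ t = S *ᵥ ψ t := fun t => by
    rw [hψ, Matrix.mulVec_mulVec, Matrix.mul_nonsing_inv _ hSdet, Matrix.one_mulVec]
  have hψL : ∀ i, MemLp (fun t => ψ t i) 2 μ := fun i =>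
    memLp_finsetSum Finset.univ (f := fun j t => S⁻¹ i j * φ t j)
      fun j _ => (hφ j).const_mul (S⁻¹ i j)
  have hortho : ∀ i j, ∫ t, ψ t i * ψ t j ∂μ = (1 : Matrix (Fin n) (Fin n) ℝ) i j := by
    intro i j
    have e1 : (1 : Matrix (Fin n) (Fin n) ℝ) = S⁻¹ * G * S⁻¹ᵀ := by
      rw [hS, ← mul_assoc, Matrix.nonsing_inv_mul _ hSdet, one_mul, ← Matrix.transpose_mul,
        Matrix.nonsing_inv_mul _ hSdet, Matrix.transpose_one]
    rw [e1, Matrix.mul_apply]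
    simp only [hψ, Matrix.mulVec, dotProduct]
    rw [integral_sum_mul_sum hφ, Finset.sum_comm]
    simp only [Matrix.mul_apply, Matrix.transpose_apply, hG, Finset.sum_mul]
    exact Finset.sum_congr rfl fun i _ => Finset.sum_congr rfl fun j _ => by ring
  have hzφ : ∀ z : α → ℝ, MemLp z 2 μ → Integrable (fun t => z t • φ t) μ := fun z hz =>
    Integrable.of_eval fun i => hz.integrable_mul (hφ i)
  have hzψ : ∀ z : α → ℝ, MemLp z 2 μ → ∀ i, Integrable (fun t => z t * ψ t i) μ := fun z hz i =>
    hz.integrable_mul (hψL i)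
  have hmap : ∀ z : α → ℝ, MemLp z 2 μ →
      ∫ t, z t • φ t ∂μ = S *ᵥ fun i => ∫ t, z t * ψ t i ∂μ := by
    intro z hz
    ext i
    rw [eval_integral (f := fun t => z t • φ t) fun i => hz.integrable_mul (hφ i)]
    simp only [Matrix.mulVec, dotProduct, ← integral_const_mul]
    rw [← integral_finsetSum _ fun j _ => (hzψ z hz j).const_mul _]
    refine integral_congr_ae (Filter.Eventually.of_forall fun t => ?_)
    simp only [Pi.smul_apply, smul_eq_mul]
    rw [hφψ t]
    simp only [Matrix.mulVec, dotProduct, Finset.mul_sum]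
    exact Finset.sum_congr rfl fun j _ => by ring
  have hsq : ∀ c : Fin n → ℝ, ∀ z : α → ℝ, MemLp z 2 μ →
      ∫ t, z t * (∑ i, c i * ψ t i) ∂μ = ∑ i, c i * ∫ t, z t * ψ t i ∂μ := by
    intro c z hz
    simp only [← integral_const_mul]
    rw [← integral_finsetSum _ fun j _ => (hzψ z hz j).const_mul _]
    refine integral_congr_ae (Filter.Eventually.of_forall fun t => ?_)
    simp only [Finset.mul_sum]
    exact Finset.sum_congr rfl fun j _ => by ring
  have hcL : ∀ c : Fin n → ℝ, MemLp (fun t => ∑ i, c i * ψ t i) 2 μ := fun c =>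
    memLp_finsetSum _ fun j _ => (hψL j).const_mul _
  have hcoef : ∀ c : Fin n → ℝ, ∀ j, ∫ t, (∑ i, c i * ψ t i) * ψ t j ∂μ = c j := by
    intro c j
    have := hsq c (fun t => ψ t j) (hψL j)
    simp only [hortho] at this
    simp_rw [mul_comm _ (ψ _ j)]
    rw [this]
    simp [Matrix.one_apply]
  have himage : {x : Fin n → ℝ | ∃ z : α → ℝ, MemLp z 2 μ ∧ eLpNorm z 2 μ ≤ 1 ∧
        Integrable (fun t => z t • φ t) μ ∧ x = ∫ t, z t • φ t ∂μ}
      = Matrix.toLin' S '' {c | ∑ i, c i ^ 2 ≤ 1} := by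
    ext x
    constructor
    · rintro ⟨z, hz, hz1, -, rfl⟩
      refine ⟨fun i => ∫ t, z t * ψ t i ∂μ, ?_, by rw [Matrix.toLin'_apply, hmap z hz]⟩
      rw [eLpNorm_two_le_one_iff hz] at hz1
      set c : Fin n → ℝ := fun i => ∫ t, z t * ψ t i ∂μ with hc
      -- Bessel's inequality: the residual `z - ∑ cᵢ ψᵢ` has nonnegative square norm.
      have h1 : 0 ≤ ∫ t, (z t - ∑ i, c i * ψ t i) ^ 2 ∂μ := integral_nonneg fun t => sq_nonneg _
      have h2 : ∫ t, (z t - ∑ i, c i * ψ t i) ^ 2 ∂μ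
          = ∫ t, z t ^ 2 ∂μ - 2 * ∫ t, z t * (∑ i, c i * ψ t i) ∂μ
            + ∫ t, (∑ i, c i * ψ t i) * (∑ i, c i * ψ t i) ∂μ := by
        have i1 := hz.integrable_sq
        have i2 : Integrable (fun t => z t * (∑ i, c i * ψ t i)) μ := hz.integrable_mul (hcL c)
        have i3 : Integrable (fun t => (∑ i, c i * ψ t i) * (∑ i, c i * ψ t i)) μ :=
          (hcL c).integrable_mul (hcL c)
        have i4 : Integrable (fun t => z t ^ 2 - 2 * (z t * (∑ i, c i * ψ t i))) μ :=
          i1.sub (i2.const_mul 2)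
        rw [← integral_const_mul, ← integral_sub i1 (i2.const_mul 2), ← integral_add i4 i3]
        refine integral_congr_ae (Filter.Eventually.of_forall fun t => ?_)
        simp only
        ring
      rw [h2, hsq c z hz, hsq c _ (hcL c)] at h1
      simp only [hcoef] at h1
      have h3 : ∑ i, c i * ∫ t, z t * ψ t i ∂μ = ∑ i, c i ^ 2 :=
        Finset.sum_congr rfl fun i _ => by rw [sq]
      rw [h3] at h1
      change ∑ i, c i ^ 2 ≤ 1
      linarith
    · rintro ⟨c, hc, rfl⟩
      refine ⟨fun t => ∑ i, c i * ψ t i, hcL c, ?_, hzφ _ (hcL c), ?_⟩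
      · rw [eLpNorm_two_le_one_iff (hcL c)]
        simp only [sq]
        rw [hsq c _ (hcL c)]
        simp only [hcoef, ← sq]
        exact hc
      · rw [hmap _ (hcL c), Matrix.toLin'_apply]
        simp only [hcoef]
  rw [himage, Measure.addHaar_image_linearMap, LinearMap.det_toLin', volume_sum_sq_le_one,
    ← ENNReal.ofReal_mul (abs_nonneg _), hdetG, abs_pow, Real.sqrt_sq (abs_nonneg _), mul_comm]

end Ellipsoid

theorem theorem4 (n : ℕ) (A : Matrix (Fin n) (Fin n) ℝ) (b : Fin n → ℝ)
    (hctrl : StateControllable A b) (hneg : HasNegativeRealEigenvalues A) :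
    (controllabilityMatrix A b).det ≠ 0 ∧
    (ccfInverseTransformation A b).det ≠ 0 ∧
    (hurwitzMatrix A).det ≠ 0 ∧
    volume (controllabilityEllipsoid A b) =
      ENNReal.ofReal (ballCoeff n * (charCoeff A (n : ℤ) / 2 ^ n) ^ (1 / 2 : ℝ) *
        |(ccfTransformation A b).det / (hurwitzMatrix A).det|) := by
  have hC := det_controllabilityMatrix_ne_zero hctrl
  have hW := abs_det_ccfInverseTransformation A b hC
  have hG := abs_det_mul_abs_det_of_lyapunov A _ b (lyapunov_gramian hneg b)
  have hH := two_pow_mul_sq_det_hurwitzMatrix A b hC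
  have ha := charpoly_coeff_zero_pos hneg
  have hdetA : |A.det| = A.charpoly.coeff 0 := by
    rw [Matrix.det_eq_sign_charpoly_coeff, abs_mul, abs_pow, abs_neg, abs_one, one_pow, one_mul,
      abs_of_pos ha]
  have hCpos : 0 < |(controllabilityMatrix A b).det| := abs_pos.mpr hC
  have hGP : 0 < |(gramian A b).det| * |(Polynomial.aeval (-A) A.charpoly).det| := by
    rw [hG]
    positivity
  have hGpos : 0 < |(gramian A b).det| := pos_of_mul_pos_left hGP (abs_nonneg _)
  have hPpos := pos_of_mul_pos_right hGP (abs_nonneg _)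
  have hHne : (hurwitzMatrix A).det ≠ 0 := by
    intro h0
    rw [h0, hdetA, abs_zero, zero_pow two_ne_zero, mul_zero] at hH
    exact (mul_pos ha hPpos).ne hH
  refine ⟨hC, fun h0 => by simp [h0] at hW, hHne, ?_⟩
  have hvol := volume_image_unitBall (μ := volume.restrict (Ioi (0 : ℝ))) (flow A b)
    (memLp_flow hneg b) (gramian A b) (fun i j => rfl) (abs_pos.mp hGpos)
  refine Eq.trans hvol ?_
  rw [mul_assoc]
  congr 2
  have hT : |(ccfTransformation A b).det| = |(controllabilityMatrix A b).det| := by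
    rw [ccfTransformation, Matrix.det_nonsing_inv, Ring.inverse_eq_inv', abs_inv]
    exact inv_eq_of_mul_eq_one_right hW
  have hHpos : 0 < |(hurwitzMatrix A).det| := abs_pos.mpr hHne
  rw [charCoeff_self, ← Real.sqrt_eq_rpow, abs_div, hT]
  rw [Real.sqrt_eq_iff_mul_self_eq (abs_nonneg _) (by positivity)]
  rw [mul_mul_mul_comm, Real.mul_self_sqrt (by positivity)]
  apply mul_right_cancel₀ hPpos.ne'
  rw [hG]
  rw [hdetA] at hH
  field_simp
  linear_combination hH
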